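/- Let $T=(V,E)$ be a free tree (a finite undirected tree) with $n=|V|$ vertices. A linear arrangement of $T$ is a bijection $\pi:V\to\{1,\dots,n\}$, and the length of an edge $uv$ in $\pi$ is $d_{uv}=|\pi(u)-\pi(v)|$. The arrangement $\pi$ is planar if no two edges $st$, $xy$ of $T$ cross, i.e. satisfy $\pi(s)<\pi(x)<\pi(t)<\pi(y)$ for some naming of their endpoints. For $r\in V$, let $T^r$ denote $T$ rooted at $r$; $\pi$ is a projective arrangement of $T^r$ if it is planar and no edge $st$ satisfies $\pi(s)<\pi(r)<\pi(t)$. Let $\mathbb{E}_{\mathrm{pl}}[d_{uv}]$ be the expected length of $uv$ in a uniformly random planar arrangement of $T$, and $\mathbb{E}_{\mathrm{pr}}^{(r)}[d_{uv}]$ its expected length in a uniformly random projective arrangement of $T^r$. For $x\in V$ let $n_r(x)$ be the number of vertices of the subtree of $T^r$ rooted at $x$, i.e. of those $w\in V$ such that $x$ lies on the path from $r$ to $w$. Then, for every edge $uv\in E$, $$\mathbb{E}_{\mathrm{pl}}[d_{uv}] = 1+\frac1n\sum_{r\in V\setminus\{u,v\}}\mathbb{E}_{\mathrm{pr}}^{(r)}[d_{uv}],$$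 and for every $r\in V$ $$\mathbb{E}_{\mathrm{pr}}^{(r)}[d_{uv}]=\frac{2\,n_r(c_r)+n_r(f_r)+1}{6},$$ where $c_r$ and $f_r$ are the endpoints of $uv$ closest to and farthest from $r$, respectively. -/

import Mathlib

/-- A linear arrangement of the `n` vertices: a bijection onto the positions. The positions
`1, …, n` are represented by `Fin n`, that is, shifted to `0, …, n - 1`; only the order of
positions and differences of positions are ever used. -/
abbrev Arrangement (V : Type*) [Fintype V] : Type _ := V ≃ Fin (Fintype.card V)

namespace Arrangement

variable {V : Type*} [Fintype V]

/-- The length `|π(u) - π(v)|` of the edge `uv` in the arrangement `π`. -/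
noncomputable def edgeLength (π : Arrangement V) (u v : V) : ℝ :=
  |((π u : ℕ) : ℝ) - ((π v : ℕ) : ℝ)|

/-- The arrangement `π` of the graph `G` is planar: no two edges `st`, `uv` of `G` cross,
i.e. satisfy `π(s) < π(u) < π(t) < π(v)` for some naming of their endpoints. -/
def IsPlanar (G : SimpleGraph V) (π : Arrangement V) : Prop :=
  ∀ s t u v : V, G.Adj s t → G.Adj u v → ¬ (π s < π u ∧ π u < π t ∧ π t < π v)

/-- The arrangement `π` of the tree `G` rooted at `r` is projective: it is planar and the root
is not covered by any edge. -/
def IsProjective (G : SimpleGraph V) (r : V) (π : Arrangement V) : Prop :=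
  IsPlanar G π ∧ ∀ s t : V, G.Adj s t → ¬ (π s < π r ∧ π r < π t)

end Arrangement

/-- The finite set of planar arrangements of `G`. -/
noncomputable def planarArrangements {V : Type*} [Fintype V] [DecidableEq V]
    (G : SimpleGraph V) : Finset (Arrangement V) :=
  open Classical in Finset.univ.filter fun π => π.IsPlanar G

/-- The finite set of projective arrangements of the tree `G` rooted at `r`. -/
noncomputable def projectiveArrangements {V : Type*} [Fintype V] [DecidableEq V]
    (G : SimpleGraph V) (r : V) : Finset (Arrangement V) :=
  open Classical in Finset.univ.filter fun π => π.IsProjective G r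

/-- The expected value of `X` over a uniformly random element of the finite set `S`. -/
noncomputable def uniformExpectation {α : Type*} (S : Finset α) (X : α → ℝ) : ℝ :=
  (∑ a ∈ S, X a) / (S.card : ℝ)

/-- Expected length of `uv` in uniformly random planar arrangements of `G`. -/
noncomputable def expectedLengthPlanar {V : Type*} [Fintype V] [DecidableEq V]
    (G : SimpleGraph V) (u v : V) : ℝ :=
  uniformExpectation (planarArrangements G) fun π => π.edgeLength u v

/-- Expected length of `uv` in uniformly random projective arrangements of `G` rooted at `r`. -/
noncomputable def expectedLengthProjective {V : Type*} [Fintype V] [DecidableEq V]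
    (G : SimpleGraph V) (r u v : V) : ℝ :=
  uniformExpectation (projectiveArrangements G r) fun π => π.edgeLength u v

/-- The vertices of the subtree hanging from `x` when the tree `G` is rooted at `r`: those `w`
for which `x` lies on the path from `r` to `w`. -/
def subtreeVertices {V : Type*} (G : SimpleGraph V) (r x : V) : Set V :=
  {w | ∃ p : G.Walk r w, p.IsPath ∧ x ∈ p.support}

/-- The directional size `n_r(x)`: the number of vertices of the subtree hanging from `x` when
`G` is rooted at `r`. -/
noncomputable def directionalSize {V : Type*} (G : SimpleGraph V) (r x : V) : ℕ :=
  (subtreeVertices G r x).ncard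

/-- The endpoint of the edge `uv` closest to `r`. (In a tree, the endpoints of an edge are
never at the same distance from `r`.) -/
noncomputable def closestEndpoint {V : Type*} (G : SimpleGraph V) (r u v : V) : V :=
  if G.dist r u < G.dist r v then u else v

/-- The endpoint of the edge `uv` farthest from `r`. -/
noncomputable def farthestEndpoint {V : Type*} (G : SimpleGraph V) (r u v : V) : V :=
  if G.dist r u < G.dist r v then v else u

/-! The length of an edge is one plus the number of vertices placed between its endpoints, so it
suffices to count, for each vertex `w`, how often `w` separates them. In a tree rooted at `r`,
projective means that every subtree is an interval (`IsProjective.isHierarchical` and its converse).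
Such arrangements are closed under swapping a vertex with a child's subtree, or two sibling
subtrees; these involutions force equal counts.

Let `c` be the parent of `f`. A vertex outside the subtree of `c` never separates them. One strictly
below `f` does so half the time, by swapping `f` with the child subtree containing it. One below
another child `g` of `c` does so a third of the time, since `c`, `f` and `g` are equally often in
the middle. With subtree sizes `n_c`, `n_f`, the mean is 1 + (n_f - 1)/2 + (n_c - n_f - 1)/3 = (2
n_c + n_f + 1)/6.

Planarity is invariant under cyclic rotation, so every vertex is equally often first, and planar
arrangements starting with `r` are the projective ones starting with `r`. If `r` is not an endpoint,
the swaps used fix `r`, so the mean is the projective one. If `r = c`, then `r` is never in the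
middle, the third becomes a half, and the mean is n/2. The two endpoints as first vertices together
contribute the summand 1. -/

namespace Arrangement

/-! ### Blocks and block swaps -/

section Exchange

variable {V : Type*} {A B : Set V} {x y w : V}

/-- Exchange of the representatives of the blocks `A ∋ x` and `B ∋ y`; vertices outside both blocks
are their own representatives. -/
noncomputable def exchange (A B : Set V) (x y w : V) : V :=
  open Classical in if w ∈ A then y else if w ∈ B then x else w

theorem exchange_left (h : w ∈ A) : exchange A B x y w = y := if_pos h

theorem exchange_right (hAB : Disjoint A B) (h : w ∈ B) : exchange A B x y w = x := by
  rw [exchange, if_neg (hAB.notMem_of_mem_right h), if_pos h]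

theorem exchange_of_notMem (hA : w ∉ A) (hB : w ∉ B) : exchange A B x y w = w := by
  rw [exchange, if_neg hA, if_neg hB]

end Exchange

variable {V : Type*} [Fintype V]

/-- Any injective key into a linear order induces an arrangement. -/
theorem exists_lt_iff_key_lt {α : Type*} [LinearOrder α] (k : V → α)
    (hk : Function.Injective k) : ∃ π : Arrangement V, ∀ v w, π v < π w ↔ k v < k w := by
  let _ : LinearOrder V := LinearOrder.lift' k hk
  let e : Fin (Fintype.card V) ≃o V := Fintype.orderIsoFinOfCardEq V rfl
  exact ⟨e.symm.toEquiv, fun v w => e.symm.lt_iff_lt⟩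

/-- The only strictly increasing bijection of `Fin n` is the identity, so an arrangement is
determined by the order it induces. -/
theorem eq_of_lt_imp_lt {π ρ : Arrangement V} (h : ∀ v w, π v < π w → ρ v < ρ w) : π = ρ := by
  have hm : StrictMono (π.symm.trans ρ) := by
    intro i j hij
    exact h _ _ (by simpa using hij)
  have he := Subsingleton.elim (hm.orderIsoOfSurjective _ (π.symm.trans ρ).surjective)
    (OrderIso.refl _)
  ext v
  have := congrArg (fun e => e (π v)) he
  simp at this
  simp [this]

/-- The block `A` occupies consecutive positions in `π`: every vertex outside `A` lies on the same
side of all vertices of `A`. -/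
def IsBlock (π : Arrangement V) (A : Set V) : Prop :=
  ∀ a ∈ A, ∀ b ∈ A, ∀ y ∉ A, π a < π y → π b < π y

theorem lt_or_lt_of_ne (π : Arrangement V) {v w : V} (h : v ≠ w) : π v < π w ∨ π w < π v :=
  lt_or_gt_of_ne (fun e => h (π.injective e))

theorem IsBlock.lt_right {π : Arrangement V} {A : Set V} (h : π.IsBlock A) {a b y : V}
    (ha : a ∈ A) (hb : b ∈ A) (hy : y ∉ A) (hlt : π y < π a) : π y < π b := by
  rcases π.lt_or_lt_of_ne (v := y) (w := b) (fun e => hy (e ▸ hb)) with h1 | h1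
  · exact h1
  · exact absurd (h b hb a ha y hy h1) (not_lt.2 hlt.le)

theorem isBlock_singleton (π : Arrangement V) (x : V) : π.IsBlock {x} := by
  rintro a rfl b rfl y - h
  exact h

section BlockSwap

variable {A B : Set V} {x y : V}

/-- The lexicographic key sends each block to the place of the other one's representative; the
tie-break by `π` keeps the internal order. -/
theorem exists_blockSwap (π : Arrangement V) (A B : Set V) (x y : V) :
    ∃ ρ : Arrangement V, ∀ v w, ρ v < ρ w ↔
      π (exchange A B x y v) < π (exchange A B x y w) ∨
        exchange A B x y v = exchange A B x y w ∧ π v < π w := by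
  obtain ⟨ρ, hρ⟩ := exists_lt_iff_key_lt (fun v => toLex (π (exchange A B x y v), π v))
    (fun v w h => by simpa using (congrArg (fun p => (ofLex p).2) h))
  refine ⟨ρ, fun v w => ?_⟩
  rw [hρ, Prod.Lex.toLex_lt_toLex]
  simp

/-- The arrangement obtained from `π` by swapping the blocks `A ∋ x` and `B ∋ y`. -/
noncomputable def blockSwap (π : Arrangement V) (A B : Set V) (x y : V) : Arrangement V :=
  (exists_blockSwap π A B x y).choose

theorem blockSwap_lt_iff (π : Arrangement V) (A B : Set V) (x y v w : V) :
    π.blockSwap A B x y v < π.blockSwap A B x y w ↔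
      π (exchange A B x y v) < π (exchange A B x y w) ∨
        exchange A B x y v = exchange A B x y w ∧ π v < π w :=
  (exists_blockSwap π A B x y).choose_spec v w

theorem blockSwap_lt_iff_of_ne (π : Arrangement V) {v w : V}
    (h : exchange A B x y v ≠ exchange A B x y w) :
    π.blockSwap A B x y v < π.blockSwap A B x y w ↔
      π (exchange A B x y v) < π (exchange A B x y w) := by
  simp [blockSwap_lt_iff, h]

theorem blockSwap_lt_iff_of_eq (π : Arrangement V) {v w : V}
    (h : exchange A B x y v = exchange A B x y w) :
    π.blockSwap A B x y v < π.blockSwap A B x y w ↔ π v < π w := by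
  simp [blockSwap_lt_iff, h]

/-- Swapping twice compares representatives from the original blocks. As both sets are blocks,
representatives compare with outside vertices as any other member does. -/
theorem blockSwap_blockSwap {π : Arrangement V} (hAB : Disjoint A B) (hx : x ∈ A) (hy : y ∈ B)
    (hA : π.IsBlock A) (hB : π.IsBlock B) :
    (π.blockSwap A B x y).blockSwap A B x y = π := by
  symm
  apply eq_of_lt_imp_lt
  intro v w hvw
  have cases (v : V) : (v ∈ A ∧ v ∉ B) ∨ (v ∉ A ∧ v ∈ B) ∨ (v ∉ A ∧ v ∉ B) := by
    have := fun h : v ∈ A => hAB.notMem_of_mem_left h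
    tauto
  have hxB := hAB.notMem_of_mem_left hx
  have hyA := hAB.notMem_of_mem_right hy
  by_cases he : exchange A B x y v = exchange A B x y w
  · rwa [blockSwap_lt_iff_of_eq _ he, blockSwap_lt_iff_of_eq _ he]
  rw [blockSwap_lt_iff_of_ne _ he, blockSwap_lt_iff]
  left
  rcases cases v with ⟨h1, h2⟩ | ⟨h1, h2⟩ | ⟨h1, h2⟩ <;>
    rcases cases w with ⟨h3, h4⟩ | ⟨h3, h4⟩ | ⟨h3, h4⟩ <;>
    simp only [exchange_left, exchange_right hAB, exchange_of_notMem, h1, h2, h3, h4, hx, hy,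
      not_false_eq_true, not_true_eq_false] at he ⊢
  · exact hA v h1 x hx y hyA (hB.lt_right h4 hy h2 hvw)
  · exact hA v h1 x hx w h3 hvw
  · exact hB v h2 y hy x hxB (hA.lt_right h3 hx h1 hvw)
  · exact hB v h2 y hy w h4 hvw
  · exact hA.lt_right h3 hx h1 hvw
  · exact hB.lt_right h4 hy h2 hvw
  · exact hvw

/-- Applies to subtrees inside one of the swapped blocks, which move rigidly. -/
theorem IsBlock.blockSwap_of_const {π : Arrangement V} {S : Set V} (hS : π.IsBlock S)
    (h : ∀ a ∈ S, ∀ b ∈ S, exchange A B x y a = exchange A B x y b) :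
    (π.blockSwap A B x y).IsBlock S := by
  intro a ha b hb z hz
  rw [blockSwap_lt_iff, blockSwap_lt_iff, h a ha b hb]
  exact Or.imp_right fun ⟨h1, h2⟩ => ⟨h1, hS a ha b hb z hz h2⟩

/-- Applies to subtrees that contain both swapped blocks or meet neither. -/
theorem IsBlock.blockSwap_of_invariant {π : Arrangement V} {S : Set V} (hS : π.IsBlock S)
    (h : ∀ w, w ∈ S ↔ exchange A B x y w ∈ S) : (π.blockSwap A B x y).IsBlock S := by
  intro a ha b hb z hz
  have ha' := (h a).1 ha
  have hb' := (h b).1 hb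
  have hz' := fun e => hz ((h z).2 e)
  rw [blockSwap_lt_iff_of_ne _ fun e => hz' (e ▸ ha'),
    blockSwap_lt_iff_of_ne _ fun e => hz' (e ▸ hb')]
  exact hS _ ha' _ hb' _ hz'

/-- The vertex `r` comes first in `π`. -/
def IsFirst (π : Arrangement V) (r : V) : Prop := ∀ w, w ≠ r → π r < π w

theorem IsFirst.blockSwap {π : Arrangement V} {r : V} (hr : π.IsFirst r) (hAB : Disjoint A B)
    (hx : x ∈ A) (hy : y ∈ B) (hA : r ∉ A) (hB : r ∉ B) : (π.blockSwap A B x y).IsFirst r := by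
  intro w hw
  have : exchange A B x y w ≠ r := by
    by_cases h1 : w ∈ A
    · rw [exchange_left h1]
      exact fun e => hB (e ▸ hy)
    by_cases h2 : w ∈ B
    · rw [exchange_right hAB h2]
      exact fun e => hA (e ▸ hx)
    rwa [exchange_of_notMem h1 h2]
  rw [blockSwap_lt_iff_of_ne] <;> rw [exchange_of_notMem hA hB]
  · exact hr _ this
  · exact this.symm

/-- The vertex `m` is placed strictly between `a` and `b`. -/
def Between (π : Arrangement V) (a m b : V) : Prop :=
  (π a < π m ∧ π m < π b) ∨ (π b < π m ∧ π m < π a)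

theorem blockSwap_between_iff (π : Arrangement V) (hAB : Disjoint A B) (hx : x ∈ A) (hy : y ∈ B)
    {z : V} (hzA : z ∉ A) (hzB : z ∉ B) :
    (π.blockSwap A B x y).Between z x y ↔ π.Between z y x := by
  have e1 : exchange A B x y x = y := exchange_left hx
  have e2 : exchange A B x y y = x := exchange_right hAB hy
  have e3 : exchange A B x y z = z := exchange_of_notMem hzA hzB
  have n1 : x ≠ y := fun e => hAB.notMem_of_mem_left hx (e ▸ hy)
  have n2 : z ≠ x := fun e => hzA (e ▸ hx)
  have n3 : z ≠ y := fun e => hzB (e ▸ hy)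
  simp only [Between, blockSwap_lt_iff, e1, e2, e3, n1, n1.symm, n3, n3.symm,
    false_and, or_false]

open Classical in
/-- If a set of arrangements is closed under swapping two blocks, then each of the two blocks is
equally often the one closer to a given outside vertex. -/
theorem card_between_eq_of_blockSwap (S : Finset (Arrangement V)) (hAB : Disjoint A B)
    (hx : x ∈ A) (hy : y ∈ B) (hA : ∀ π ∈ S, π.IsBlock A) (hB : ∀ π ∈ S, π.IsBlock B)
    (hS : ∀ π ∈ S, π.blockSwap A B x y ∈ S) {z : V} (hzA : z ∉ A) (hzB : z ∉ B) :
    (S.filter fun π => π.Between z x y).card = (S.filter fun π => π.Between z y x).card := by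
  have inv : ∀ π ∈ S, (π.blockSwap A B x y).blockSwap A B x y = π := fun π hπ =>
    blockSwap_blockSwap hAB hx hy (hA π hπ) (hB π hπ)
  refine Finset.card_nbij' (fun π => π.blockSwap A B x y) (fun π => π.blockSwap A B x y) ?_ ?_ ?_ ?_
  · intro π hπ
    simp only [Finset.coe_filter, Set.mem_ofPred_eq] at hπ ⊢
    refine ⟨hS π hπ.1, ?_⟩
    rw [← blockSwap_between_iff _ hAB hx hy hzA hzB, inv π hπ.1]
    exact hπ.2
  · intro π hπ
    simp only [Finset.coe_filter, Set.mem_ofPred_eq] at hπ ⊢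
    exact ⟨hS π hπ.1, (blockSwap_between_iff _ hAB hx hy hzA hzB).2 hπ.2⟩
  · intro π hπ
    exact inv π (Finset.mem_filter.1 hπ).1
  · intro π hπ
    exact inv π (Finset.mem_filter.1 hπ).1

end BlockSwap

/-! ### Betweenness and edge length -/

theorem between_comm {π : Arrangement V} {a m b : V} : π.Between a m b ↔ π.Between b m a :=
  Or.comm

theorem IsBlock.between_iff {π : Arrangement V} {A : Set V} (hA : π.IsBlock A) {m m' a b : V}
    (hm : m ∈ A) (hm' : m' ∈ A) (ha : a ∉ A) (hb : b ∉ A) :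
    π.Between a m b ↔ π.Between a m' b := by
  have h1 : ∀ {y}, y ∉ A → (π m < π y ↔ π m' < π y) := fun hy =>
    ⟨hA m hm m' hm' _ hy, hA m' hm' m hm _ hy⟩
  have h2 : ∀ {y}, y ∉ A → (π y < π m ↔ π y < π m') := fun hy =>
    ⟨hA.lt_right hm hm' hy, hA.lt_right hm' hm hy⟩
  simp only [Between, h1 ha, h1 hb, h2 ha, h2 hb]

theorem IsBlock.not_between {π : Arrangement V} {A : Set V} (hA : π.IsBlock A) {m a b : V}
    (ha : a ∈ A) (hb : b ∈ A) (hm : m ∉ A) : ¬ π.Between a m b := by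
  rintro (⟨h1, h2⟩ | ⟨h1, h2⟩)
  · exact absurd (hA a ha b hb m hm h1) (not_lt.2 h2.le)
  · exact absurd (hA b hb a ha m hm h1) (not_lt.2 h2.le)

open Classical in
theorem edgeLength_eq_one_add_card_between (π : Arrangement V) {u v : V} (h : u ≠ v) :
    π.edgeLength u v = 1 + ((Finset.univ.filter fun w => π.Between u w v).card : ℝ) := by
  wlog huv : π u < π v generalizing u v
  · have := this h.symm ((π.lt_or_lt_of_ne h).resolve_left huv)
    rw [edgeLength, abs_sub_comm, ← edgeLength, this]
    simp only [between_comm]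
  have h1 : (Finset.univ.filter fun w => π.Between u w v).map π.toEmbedding
      = Finset.Ioo (π u) (π v) := by
    ext i
    rw [Finset.mem_map_equiv, Finset.mem_filter, Finset.mem_Ioo, Between,
      Equiv.apply_symm_apply, and_iff_right (Finset.mem_univ _)]
    constructor
    · rintro (h | ⟨h1, h2⟩)
      · exact h
      · exact absurd (h1.trans h2) (not_lt.2 huv.le)
    · exact Or.inl
  rw [← Finset.card_map π.toEmbedding, h1, Fin.card_Ioo, edgeLength]
  have huv' : (π u : ℕ) + 1 ≤ (π v : ℕ) := huv
  rw [Nat.sub_sub, Nat.cast_sub huv']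
  have : ((π u : ℕ) : ℝ) + 1 ≤ (π v : ℕ) := by exact_mod_cast huv'
  rw [abs_of_nonpos (by linarith)]
  push_cast
  ring

theorem edgeLength_comm (π : Arrangement V) (u v : V) : π.edgeLength u v = π.edgeLength v u :=
  abs_sub_comm _ _

end Arrangement

/-! ### Subtrees of a rooted tree -/

namespace SimpleGraph

variable {V : Type*} {G : SimpleGraph V}

theorem eq_of_root_mem_subtreeVertices {r x : V} (h : r ∈ subtreeVertices G r x) : x = r := by
  obtain ⟨p, hp, hx⟩ := h
  rw [(Walk.isPath_iff_nil.1 hp).eq_nil] at hx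
  simpa using hx

/-- Every vertex set that contains `x` but not some `b` below `x` is left along an edge of the
subtree hanging from `x`. -/
theorem exists_boundary_adj_in_subtreeVertices {r x b : V} (S : Set V)
    (hb : b ∈ subtreeVertices G r x) (hxS : x ∈ S) (hbS : b ∉ S) :
    ∃ s t, G.Adj s t ∧ s ∈ S ∧ t ∉ S ∧ s ∈ subtreeVertices G r x ∧
      t ∈ subtreeVertices G r x := by
  classical
  obtain ⟨p, hp, h⟩ := hb
  obtain ⟨d, hd, hd1, hd2⟩ := (p.dropUntil x h).exists_boundary_dart S hxS hbS
  have key : ∀ z ∈ (p.dropUntil x h).support, z ∈ subtreeVertices G r x := by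
    intro z hz
    refine ⟨(p.takeUntil x h).append ((p.dropUntil x h).takeUntil z hz), ?_, ?_⟩
    · apply Walk.IsPath.of_append_left (q := (p.dropUntil x h).dropUntil z hz)
      rw [← Walk.append_assoc, Walk.take_spec, Walk.take_spec]
      exact hp
    · rw [Walk.mem_support_append_iff]
      exact Or.inl (Walk.end_mem_support _)
  exact ⟨d.fst, d.snd, d.adj, hd1, hd2, key _ (Walk.dart_fst_mem_support_of_mem_darts _ hd),
    key _ (Walk.dart_snd_mem_support_of_mem_darts _ hd)⟩

namespace IsTree

theorem mem_support_of_mem_subtreeVertices (hG : G.IsTree) {r x w : V}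
    (h : w ∈ subtreeVertices G r x) {p : G.Walk r w} (hp : p.IsPath) : x ∈ p.support := by
  obtain ⟨q, hq, hx⟩ := h
  rwa [(hG.existsUnique_path r w).unique hp hq]

theorem exists_isPath (hG : G.IsTree) (v w : V) : ∃ p : G.Walk v w, p.IsPath :=
  (hG.existsUnique_path v w).exists

theorem self_mem_subtreeVertices (hG : G.IsTree) (r x : V) : x ∈ subtreeVertices G r x := by
  obtain ⟨p, hp⟩ := hG.exists_isPath r x
  exact ⟨p, hp, p.end_mem_support⟩

theorem mem_subtreeVertices_root (hG : G.IsTree) (r w : V) : w ∈ subtreeVertices G r r := by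
  obtain ⟨p, hp⟩ := hG.exists_isPath r w
  exact ⟨p, hp, p.start_mem_support⟩

theorem subtreeVertices_trans (hG : G.IsTree) {r x y w : V} (hy : y ∈ subtreeVertices G r x)
    (hw : w ∈ subtreeVertices G r y) : w ∈ subtreeVertices G r x := by
  classical
  obtain ⟨p, hp, h⟩ := hw
  exact ⟨p, hp, p.support_takeUntil_subset_support h
    (hG.mem_support_of_mem_subtreeVertices hy (hp.takeUntil h))⟩

theorem subtreeVertices_antisymm (hG : G.IsTree) {r x y : V} (hy : y ∈ subtreeVertices G r x)
    (hx : x ∈ subtreeVertices G r y) : x = y := by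
  classical
  obtain ⟨p, hp, h⟩ := hy
  by_contra hne
  exact Walk.endpoint_notMem_support_takeUntil hp h (Ne.symm hne)
    (hG.mem_support_of_mem_subtreeVertices hx (hp.takeUntil h))

/-- The root paths to `x` and `y` are prefixes of the root path to `w`, and two prefixes of one list
are comparable. -/
theorem subtreeVertices_laminar (hG : G.IsTree) {r x y w : V} (hx : w ∈ subtreeVertices G r x)
    (hy : w ∈ subtreeVertices G r y) :
    y ∈ subtreeVertices G r x ∨ x ∈ subtreeVertices G r y := by
  classical
  obtain ⟨p, hp, h⟩ := hx
  have h' := hG.mem_support_of_mem_subtreeVertices hy hp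
  have h1 := p.support_takeUntil_prefix_support h
  have h2 := p.support_takeUntil_prefix_support h'
  rcases List.prefix_or_prefix_of_prefix h1 h2 with h3 | h3
  · exact Or.inl ⟨_, hp.takeUntil h', h3.subset (Walk.end_mem_support _)⟩
  · exact Or.inr ⟨_, hp.takeUntil h, h3.subset (Walk.end_mem_support _)⟩

theorem adj_mem_subtreeVertices_or (hG : G.IsTree) (r : V) {u v : V} (h : G.Adj u v) :
    v ∈ subtreeVertices G r u ∨ u ∈ subtreeVertices G r v := by
  obtain ⟨p, hp⟩ := hG.exists_isPath r u
  by_cases hv : v ∈ p.support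
  · exact Or.inr ⟨p, hp, hv⟩
  · exact Or.inl ⟨p.concat h, hp.concat hv h, by simp [Walk.support_concat]⟩

/-- If `f` is a child of `c`, then the ancestors of `f` are `f` and the ancestors of `c`. -/
theorem eq_or_mem_subtreeVertices_of_adj (hG : G.IsTree) {r c f z : V} (h : G.Adj c f)
    (hf : f ∈ subtreeVertices G r c) (hz : f ∈ subtreeVertices G r z) :
    z = f ∨ c ∈ subtreeVertices G r z := by
  obtain ⟨p, hp⟩ := hG.exists_isPath r c
  have hfp : f ∉ p.support := fun h' => h.ne (hG.subtreeVertices_antisymm hf ⟨p, hp, h'⟩)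
  have := hG.mem_support_of_mem_subtreeVertices hz (hp.concat hfp h)
  rw [Walk.support_concat] at this
  simp at this
  rcases this with h1 | h1
  · exact Or.inr ⟨p, hp, h1⟩
  · exact Or.inl h1

theorem exists_child_of_mem_subtreeVertices (hG : G.IsTree) {r c w : V}
    (hw : w ∈ subtreeVertices G r c) (hne : w ≠ c) :
    ∃ g, G.Adj c g ∧ g ∈ subtreeVertices G r c ∧ w ∈ subtreeVertices G r g := by
  classical
  obtain ⟨p, hp, h⟩ := hw
  obtain ⟨d, hd, hd1, hd2⟩ := (p.dropUntil c h).exists_boundary_dart {c} rfl hne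
  obtain rfl : d.fst = c := hd1
  have hs : d.snd ∈ p.support :=
    p.support_dropUntil_subset_support h (Walk.dart_snd_mem_support_of_mem_darts _ hd)
  refine ⟨d.snd, d.adj, ?_, p, hp, hs⟩
  rcases hG.adj_mem_subtreeVertices_or r d.adj with h1 | h1
  · exact h1
  exfalso
  -- If the successor of `c` on the path were an ancestor of `c`, it would occur on the path both
  -- before and after `c`.
  have h2 := hG.mem_support_of_mem_subtreeVertices h1 (hp.takeUntil h)
  have h3 : d.snd ∈ (p.dropUntil d.fst h).support.tail := by
    have := Walk.dart_snd_mem_support_of_mem_darts _ hd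
    rw [← Walk.cons_tail_support, List.mem_cons] at this
    exact this.resolve_left hd2
  have h4 := hp.support_nodup
  rw [← p.take_spec h, Walk.support_append] at h4
  exact (List.nodup_append.1 h4).2.2 _ h2 _ h3 rfl

/-- Every vertex set that contains the root but not some `y` outside the subtree hanging from `x`
is left along an edge outside that subtree. -/
theorem exists_boundary_adj_notMem_subtreeVertices (hG : G.IsTree) {r x y : V} (S : Set V)
    (hy : y ∉ subtreeVertices G r x) (hrS : r ∈ S) (hyS : y ∉ S) :
    ∃ s t, G.Adj s t ∧ s ∈ S ∧ t ∉ S ∧ s ∉ subtreeVertices G r x ∧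
      t ∉ subtreeVertices G r x := by
  classical
  obtain ⟨p, hp⟩ := hG.exists_isPath r y
  obtain ⟨d, hd, hd1, hd2⟩ := p.exists_boundary_dart S hrS hyS
  have key : ∀ z ∈ p.support, z ∉ subtreeVertices G r x := fun z hz hzx =>
    hy (hG.subtreeVertices_trans hzx ⟨p, hp, hz⟩)
  exact ⟨d.fst, d.snd, d.adj, hd1, hd2, key _ (Walk.dart_fst_mem_support_of_mem_darts _ hd),
    key _ (Walk.dart_snd_mem_support_of_mem_darts _ hd)⟩

theorem mem_subtreeVertices_of_dist_lt (hG : G.IsTree) {r u v : V} (h : G.Adj u v)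
    (hd : G.dist r u < G.dist r v) : v ∈ subtreeVertices G r u := by
  classical
  refine (hG.adj_mem_subtreeVertices_or r h).resolve_right fun h1 => ?_
  obtain ⟨p, hp, hl⟩ := hG.connected.exists_path_of_dist r u
  have h2 := hG.mem_support_of_mem_subtreeVertices h1 hp
  have h3 := dist_le (p.takeUntil v h2)
  have h4 := p.length_takeUntil_le_length h2
  omega

theorem mem_subtreeVertices_of_not_dist_lt (hG : G.IsTree) {r u v : V} (h : G.Adj u v)
    (hd : ¬ G.dist r u < G.dist r v) : u ∈ subtreeVertices G r v := by
  classical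
  refine (hG.adj_mem_subtreeVertices_or r h).resolve_left fun h1 => hd ?_
  obtain ⟨p, hp, hl⟩ := hG.connected.exists_path_of_dist r v
  have h2 := hG.mem_support_of_mem_subtreeVertices h1 hp
  have h3 := dist_le (p.takeUntil u h2)
  have h4 := p.length_takeUntil_lt_length h2 h.ne
  omega

/-- Every edge `st` has an upper endpoint `c`. -/
theorem exists_top_of_adj (hG : G.IsTree) (r : V) {s t : V} (h : G.Adj s t) :
    ∃ c, (c = s ∨ c = t) ∧ s ∈ subtreeVertices G r c ∧ t ∈ subtreeVertices G r c ∧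
      ∀ z, (s ∈ subtreeVertices G r z ∨ t ∈ subtreeVertices G r z) →
        z = s ∨ z = t ∨ c ∈ subtreeVertices G r z := by
  rcases hG.adj_mem_subtreeVertices_or r h with h1 | h1
  · refine ⟨s, Or.inl rfl, hG.self_mem_subtreeVertices r s, h1, ?_⟩
    rintro z (hz | hz)
    · exact Or.inr (Or.inr hz)
    · exact Or.inr (hG.eq_or_mem_subtreeVertices_of_adj h h1 hz)
  · refine ⟨t, Or.inr rfl, h1, hG.self_mem_subtreeVertices r t, ?_⟩
    rintro z (hz | hz)
    · rcases hG.eq_or_mem_subtreeVertices_of_adj h.symm h1 hz with h2 | h2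
      · exact Or.inl h2
      · exact Or.inr (Or.inr h2)
    · exact Or.inr (Or.inr hz)

theorem disjoint_subtreeVertices_of_siblings (hG : G.IsTree) {r c x y : V}
    (hcx : G.Adj c x) (hx : x ∈ subtreeVertices G r c) (hcy : G.Adj c y)
    (hy : y ∈ subtreeVertices G r c) (hne : x ≠ y) :
    Disjoint (subtreeVertices G r x) (subtreeVertices G r y) := by
  rw [Set.disjoint_left]
  intro w hwx hwy
  rcases hG.subtreeVertices_laminar hwx hwy with h1 | h1
  · rcases hG.eq_or_mem_subtreeVertices_of_adj hcy hy h1 with h2 | h2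
    · exact hne h2
    · exact hcx.ne (hG.subtreeVertices_antisymm hx h2)
  · rcases hG.eq_or_mem_subtreeVertices_of_adj hcx hx h1 with h2 | h2
    · exact hne h2.symm
    · exact hcy.ne (hG.subtreeVertices_antisymm hy h2)

end IsTree

end SimpleGraph

/-! ### Projective arrangements are those with consecutive subtrees -/

namespace Arrangement

variable {V : Type*} [Fintype V] {G : SimpleGraph V} {r : V} {π : Arrangement V}

/-- Every subtree of `G` rooted at `r` occupies consecutive positions in `π`. -/
def IsHierarchical (G : SimpleGraph V) (r : V) (π : Arrangement V) : Prop :=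
  ∀ x, π.IsBlock (subtreeVertices G r x)

theorem IsProjective.isHierarchical (hG : G.IsTree) (h : π.IsProjective G r) :
    π.IsHierarchical G r := by
  intro x a ha b hb y hy hay
  by_contra hby
  have hne : ∀ {w}, w ∈ subtreeVertices G r x → y ≠ w := fun hw e => hy (e ▸ hw)
  replace hby : π y < π b := (π.lt_or_lt_of_ne (hne hb)).resolve_right hby
  have hx := hG.self_mem_subtreeVertices r x
  -- `x` lies on one side of `y`, and `a` or `b` on the other; the path from `x` down to that vertex
  -- stays in the subtree and jumps over `y`.
  obtain ⟨s, t, hst, hs, ht, hsy, hyt⟩ : ∃ s t, G.Adj s t ∧ s ∈ subtreeVertices G r x ∧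
      t ∈ subtreeVertices G r x ∧ π s < π y ∧ π y < π t := by
    rcases π.lt_or_lt_of_ne (hne hx) with hyx | hxy
    · obtain ⟨s, t, hst, hsS, htS, hs, ht⟩ :=
        SimpleGraph.exists_boundary_adj_in_subtreeVertices {w | π y < π w} ha hyx
          (not_lt.2 hay.le)
      exact ⟨t, s, hst.symm, ht, hs, (π.lt_or_lt_of_ne (hne ht)).resolve_left htS, hsS⟩
    · obtain ⟨s, t, hst, hsS, htS, hs, ht⟩ :=
        SimpleGraph.exists_boundary_adj_in_subtreeVertices {w | π w < π y} hb hxy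
          (not_lt.2 hby.le)
      exact ⟨s, t, hst, hs, ht, hsS, (π.lt_or_lt_of_ne (hne ht)).resolve_right htS⟩
  -- The root is not covered by `st`, but `y` is. The path from the root to `y` avoids the subtree,
  -- so it enters the span of `st` by an edge disjoint from `st`, which must cross `st`.
  obtain ⟨p, q, hpq, hpS, hqS, hp, hq⟩ := hG.exists_boundary_adj_notMem_subtreeVertices
    {w | ¬ (π s < π w ∧ π w < π t)} hy (h.2 s t hst) (fun h => h ⟨hsy, hyt⟩)
  obtain ⟨hsq, hqt⟩ : π s < π q ∧ π q < π t := not_not.1 hqS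
  rcases π.lt_or_lt_of_ne (v := p) (w := s) (fun e => hp (e ▸ hs)) with h1 | h1
  · exact h.1 p q s t hpq hst ⟨h1, hsq, hqt⟩
  rcases π.lt_or_lt_of_ne (v := p) (w := t) (fun e => hp (e ▸ ht)) with h2 | h2
  · exact hpS ⟨h1, h2⟩
  · exact h.1 s t q p hst hpq.symm ⟨hsq, hqt, h2⟩

theorem IsHierarchical.mem_of_lt_of_lt (h : π.IsHierarchical G r) {x a y b : V}
    (ha : a ∈ subtreeVertices G r x) (hb : b ∈ subtreeVertices G r x) (h1 : π a < π y)
    (h2 : π y < π b) : y ∈ subtreeVertices G r x := by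
  by_contra hy
  exact (h x).not_between ha hb hy (Or.inl ⟨h1, h2⟩)

/-- For crossing edges, each upper endpoint is an ancestor of an endpoint of the other edge, hence
of the other upper endpoint. The two would coincide, but the edges are disjoint. If an edge covered
the root, the root would be its upper endpoint. -/
theorem IsHierarchical.isProjective (hG : G.IsTree) (h : π.IsHierarchical G r) :
    π.IsProjective G r := by
  constructor
  · rintro s t u v hst huv ⟨h1, h2, h3⟩
    have n1 : s ≠ u := fun e => h1.ne (e ▸ rfl)
    have n2 : u ≠ t := fun e => h2.ne (e ▸ rfl)
    have n3 : t ≠ v := fun e => h3.ne (e ▸ rfl)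
    have n4 : s ≠ v := fun e => (h1.trans (h2.trans h3)).ne (e ▸ rfl)
    obtain ⟨c, hc, hsc, htc, hct⟩ := hG.exists_top_of_adj r hst
    obtain ⟨d, hd, hud, hvd, hdt⟩ := hG.exists_top_of_adj r huv
    have hu := h.mem_of_lt_of_lt hsc htc h1 h2
    have ht := h.mem_of_lt_of_lt hud hvd h2 h3
    have e1 := hct d (Or.inr ht)
    have e2 := hdt c (Or.inl hu)
    have key := @SimpleGraph.IsTree.subtreeVertices_antisymm V G hG r c d
    grind
  · rintro s t hst ⟨h1, h2⟩
    obtain ⟨c, hc, hsc, htc, -⟩ := hG.exists_top_of_adj r hst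
    have hcr := SimpleGraph.eq_of_root_mem_subtreeVertices (h.mem_of_lt_of_lt hsc htc h1 h2)
    rcases hc with rfl | rfl
    · exact h1.ne (by rw [hcr])
    · exact h2.ne (by rw [hcr])

/-- Swapping a vertex with the subtree of one of its children preserves hierarchical
arrangements. -/
theorem IsHierarchical.blockSwap_child (hG : G.IsTree) (h : π.IsHierarchical G r) {x y : V}
    (hxy : G.Adj x y) (hy : y ∈ subtreeVertices G r x) :
    (π.blockSwap {x} (subtreeVertices G r y) x y).IsHierarchical G r := by
  have hx : x ∉ subtreeVertices G r y := fun h' =>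
    hxy.ne (hG.subtreeVertices_antisymm hy h')
  have hd : Disjoint {x} (subtreeVertices G r y) := Set.disjoint_singleton_left.2 hx
  intro z
  by_cases hz : z ∈ subtreeVertices G r y
  · refine (h z).blockSwap_of_const fun a ha b hb => ?_
    rw [exchange_right hd (hG.subtreeVertices_trans hz ha),
      exchange_right hd (hG.subtreeVertices_trans hz hb)]
  refine (h z).blockSwap_of_invariant fun w => ?_
  -- A subtree not rooted below `y` contains `x` as soon as it contains `y`.
  have hyz : y ∈ subtreeVertices G r z → x ∈ subtreeVertices G r z := fun h' =>
    (hG.eq_or_mem_subtreeVertices_of_adj hxy hy h').resolve_left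
      fun e => hz (e ▸ hG.self_mem_subtreeVertices r y)
  by_cases h1 : w ∈ ({x} : Set V)
  · rw [exchange_left h1, Set.mem_singleton_iff.1 h1]
    exact ⟨fun h' => hG.subtreeVertices_trans h' hy, hyz⟩
  by_cases h2 : w ∈ subtreeVertices G r y
  · rw [exchange_right hd h2]
    exact ⟨fun h' => hyz ((hG.subtreeVertices_laminar h' h2).resolve_right hz),
      fun h' => hG.subtreeVertices_trans h' (hG.subtreeVertices_trans hy h2)⟩
  rw [exchange_of_notMem h1 h2]

/-- Swapping the subtrees of two children of a vertex preserves hierarchical arrangements. -/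
theorem IsHierarchical.blockSwap_siblings (hG : G.IsTree) (h : π.IsHierarchical G r) {c x y : V}
    (hcx : G.Adj c x) (hx : x ∈ subtreeVertices G r c) (hcy : G.Adj c y)
    (hy : y ∈ subtreeVertices G r c) (hne : x ≠ y) :
    (π.blockSwap (subtreeVertices G r x) (subtreeVertices G r y) x y).IsHierarchical G r := by
  have hd := hG.disjoint_subtreeVertices_of_siblings hcx hx hcy hy hne
  intro z
  by_cases hzx : z ∈ subtreeVertices G r x
  · refine (h z).blockSwap_of_const fun a ha b hb => ?_
    rw [exchange_left (hG.subtreeVertices_trans hzx ha),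
      exchange_left (hG.subtreeVertices_trans hzx hb)]
  by_cases hzy : z ∈ subtreeVertices G r y
  · refine (h z).blockSwap_of_const fun a ha b hb => ?_
    rw [exchange_right hd (hG.subtreeVertices_trans hzy ha),
      exchange_right hd (hG.subtreeVertices_trans hzy hb)]
  refine (h z).blockSwap_of_invariant fun w => ?_
  -- A subtree rooted in neither block that meets one of them contains `c`, hence both.
  have above : ∀ {x}, G.Adj c x → x ∈ subtreeVertices G r c → z ∉ subtreeVertices G r x →
      ∀ {w}, w ∈ subtreeVertices G r x → w ∈ subtreeVertices G r z →
        c ∈ subtreeVertices G r z := fun {x} hcx hx hzx {w} hw hwz =>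
    (hG.eq_or_mem_subtreeVertices_of_adj hcx hx
      ((hG.subtreeVertices_laminar hwz hw).resolve_right hzx)).resolve_left
        fun e => hzx (e ▸ hG.self_mem_subtreeVertices r x)
  by_cases h1 : w ∈ subtreeVertices G r x
  · rw [exchange_left h1]
    exact ⟨fun h' => hG.subtreeVertices_trans (above hcx hx hzx h1 h') hy,
      fun h' => hG.subtreeVertices_trans
        (above hcy hy hzy (hG.self_mem_subtreeVertices r y) h')
        (hG.subtreeVertices_trans hx h1)⟩
  by_cases h2 : w ∈ subtreeVertices G r y
  · rw [exchange_right hd h2]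
    exact ⟨fun h' => hG.subtreeVertices_trans (above hcy hy hzy h2 h') hx,
      fun h' => hG.subtreeVertices_trans
        (above hcx hx hzx (hG.self_mem_subtreeVertices r x) h')
        (hG.subtreeVertices_trans hy h2)⟩
  rw [exchange_of_notMem h1 h2]

end Arrangement

/-! ### Existence of hierarchical arrangements -/

theorem List.lt_of_lt_of_prefix {α : Type*} [LinearOrder α] {p a b y : List α} (ha : p <+: a)
    (hb : p <+: b) (hy : ¬ p <+: y) (h : a < y) : b < y := by
  induction p generalizing a b y with
  | nil => exact absurd List.nil_prefix hy
  | cons x p ih =>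
    obtain ⟨a, rfl⟩ := ha
    obtain ⟨b, rfl⟩ := hb
    cases y with
    | nil => exact absurd h (List.not_lt_nil _)
    | cons k y =>
      rw [List.cons_append, List.cons_lt_cons_iff] at h ⊢
      refine h.imp_right fun ⟨h1, h2⟩ => ⟨h1, ?_⟩
      subst h1
      refine ih (List.prefix_append _ _) (List.prefix_append _ _) (fun h3 => hy ?_) h2
      exact List.cons_prefix_cons.2 ⟨rfl, h3⟩

namespace Arrangement

variable {V : Type*} [Fintype V] {G : SimpleGraph V}

/-- The depth-first arrangement is hierarchical and starts with the root. -/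
theorem exists_isHierarchical_isFirst (hG : G.IsTree) (r : V) :
    ∃ π : Arrangement V, π.IsHierarchical G r ∧ π.IsFirst r := by
  classical
  let e := Fintype.equivFin V
  choose p hp using hG.exists_isPath r
  -- Sorting by labelled root paths: descent becomes the prefix relation, and lists with a common
  -- prefix are consecutive in lexicographic order.
  let k : V → List (Fin (Fintype.card V)) := fun w => (p w).support.map e
  have hpre : ∀ z w, w ∈ subtreeVertices G r z ↔ k z <+: k w := by
    intro z w
    constructor
    · intro h
      have h1 := hG.mem_support_of_mem_subtreeVertices h (hp w)
      have h2 : (p w).takeUntil z h1 = p z :=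
        (hG.existsUnique_path r z).unique ((hp w).takeUntil h1) (hp z)
      have h3 := (p w).support_takeUntil_prefix_support h1
      rw [h2] at h3
      exact h3.map e
    · intro h
      have h1 : e z ∈ k w := h.subset (List.mem_map_of_mem (p z).end_mem_support)
      exact ⟨p w, hp w, (List.mem_map_of_injective e.injective).1 h1⟩
  have hk : Function.Injective k := fun v w h =>
    hG.subtreeVertices_antisymm ((hpre v w).2 (h ▸ List.prefix_rfl))
      ((hpre w v).2 (h ▸ List.prefix_rfl))
  obtain ⟨π, hπ⟩ := exists_lt_iff_key_lt k hk
  refine ⟨π, fun x a ha b hb y hy h => ?_, fun w hw => ?_⟩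
  · rw [hpre] at ha hb hy
    rw [hπ] at h ⊢
    exact List.lt_of_lt_of_prefix ha hb hy h
  · rw [hπ]
    have h1 := (hpre r w).1 (hG.mem_subtreeVertices_root r w)
    exact lt_of_le_of_ne (not_lt.1 h1.le) (fun h => hw (hk h).symm)

end Arrangement

/-! ### Total edge lengths from swap symmetries -/

namespace Arrangement

variable {V : Type*} [Fintype V] {G : SimpleGraph V} {r : V}

open Classical in
theorem sum_edgeLength_eq_card_add_sum_card_between (S : Finset (Arrangement V)) {u v : V}
    (h : u ≠ v) : ∑ π ∈ S, π.edgeLength u v =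
      S.card + ∑ w, ((S.filter fun π => π.Between u w v).card : ℝ) := by
  simp_rw [edgeLength_eq_one_add_card_between _ h, Finset.sum_add_distrib, Finset.card_filter]
  push_cast
  rw [Finset.sum_comm]
  simp

open Classical in
/-- The total length of the edge from `c` to its child `f` over a set of hierarchical arrangements
that is closed under the swaps of `f` with the subtrees of its children, given how often the other
children of `c` separate `c` from `f`. -/
theorem sum_edgeLength_of_isHierarchical (hG : G.IsTree) {S : Finset (Arrangement V)}
    (hS : ∀ π ∈ S, π.IsHierarchical G r) {c f : V} (hcf : G.Adj c f)
    (hf : f ∈ subtreeVertices G r c)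
    (hswap : ∀ g, G.Adj f g → g ∈ subtreeVertices G r f →
      ∀ π ∈ S, π.blockSwap {f} (subtreeVertices G r g) f g ∈ S) (κ : ℝ)
    (hκ : ∀ g, G.Adj c g → g ∈ subtreeVertices G r c → g ≠ f →
      ((S.filter fun π => π.Between c g f).card : ℝ) = κ * S.card) :
    ∑ π ∈ S, π.edgeLength c f = S.card * (1 + ((directionalSize G r f : ℝ) - 1) / 2 +
      κ * ((directionalSize G r c : ℝ) - directionalSize G r f - 1)) := by
  have hcf' : c ∉ subtreeVertices G r f := fun h =>
    hcf.ne (hG.subtreeVertices_antisymm hf h)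
  have hff := hG.self_mem_subtreeVertices r f
  have hcc := hG.self_mem_subtreeVertices r c
  -- The indicators give weight 1/2 to vertices strictly below `f`, `κ` to those strictly below `c`
  -- but not in the subtree of `f`, and 0 to the rest.
  have hcard : ∀ w, ((S.filter fun π => π.Between c w f).card : ℝ) = S.card *
      (((if w ∈ subtreeVertices G r f then 1 else 0) - (if w = f then 1 else 0)) * (1 / 2) +
        κ * ((if w ∈ subtreeVertices G r c then 1 else 0) -
          (if w ∈ subtreeVertices G r f then 1 else 0) - (if w = c then 1 else 0))) := by
    intro w
    have hzero (h : ∀ π ∈ S, ¬ π.Between c w f) :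
        ((S.filter fun π => π.Between c w f).card : ℝ) = 0 := by
      rw [Finset.filter_false_of_mem h]
      simp
    by_cases hwf : w = f
    · subst hwf
      rw [hzero fun π _ => by simp [Between]]
      simp [hff, hf, hcf.ne']
    by_cases hwc : w = c
    · subst hwc
      rw [hzero fun π _ => by simp [Between]]
      simp [hcf', hcc, hcf.ne]
    by_cases hwf' : w ∈ subtreeVertices G r f
    · obtain ⟨g, hfg, hg, hwg⟩ := hG.exists_child_of_mem_subtreeVertices hwf' hwf
      have hfg' : f ∉ subtreeVertices G r g := fun h =>
        hfg.ne (hG.subtreeVertices_antisymm hg h)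
      have hcg' : c ∉ subtreeVertices G r g := fun h =>
        hcf' (hG.subtreeVertices_trans hg h)
      have hgg := hG.self_mem_subtreeVertices r g
      have e1 : (S.filter fun π => π.Between c w f) = S.filter fun π => π.Between c g f :=
        Finset.filter_congr fun π hπ => (hS π hπ g).between_iff hwg hgg hcg' hfg'
      have e2 := card_between_eq_of_blockSwap S (Set.disjoint_singleton_left.2 hfg')
        (Set.mem_singleton f) hgg (fun π _ => π.isBlock_singleton f) (fun π hπ => hS π hπ g)
        (hswap g hfg hg) (z := c) (by simpa using hcf.ne) hcg'
      -- `c` lies outside the block of `f`, so exactly one of `f` and `g` is nearer to `c`.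
      have e3 : (S.filter fun π => π.Between c f g) = S.filter fun π => ¬ π.Between c g f := by
        refine Finset.filter_congr fun π hπ => ?_
        have h1 := (hS π hπ f).not_between hff hg hcf'
        have h2 := π.lt_or_lt_of_ne hcf.ne
        have h3 := π.lt_or_lt_of_ne hfg.ne
        have h4 : π c < π g ∨ π g < π c := π.lt_or_lt_of_ne (fun e => hcg' (e ▸ hgg))
        simp only [Between] at h1 ⊢
        grind
      have e4 := Finset.card_filter_add_card_filter_not (s := S) (fun π => π.Between c g f)
      rw [← e3, e2, ← e1] at e4
      have e5 : ((S.filter fun π => π.Between c w f).card : ℝ) +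
        (S.filter fun π => π.Between c w f).card = S.card := by exact_mod_cast e4
      simp only [hwf', hwf, hwc, hG.subtreeVertices_trans hf hwf', if_true, if_false]
      linarith
    by_cases hwc' : w ∈ subtreeVertices G r c
    · obtain ⟨g, hcg, hg, hwg⟩ := hG.exists_child_of_mem_subtreeVertices hwc' hwc
      have hgf : g ≠ f := fun e => hwf' (e ▸ hwg)
      have hd := hG.disjoint_subtreeVertices_of_siblings hcg hg hcf hf hgf
      have hcg' : c ∉ subtreeVertices G r g := fun h =>
        hcg.ne (hG.subtreeVertices_antisymm hg h)
      have e1 : (S.filter fun π => π.Between c w f) = S.filter fun π => π.Between c g f :=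
        Finset.filter_congr fun π hπ => (hS π hπ g).between_iff hwg
          (hG.self_mem_subtreeVertices r g) hcg' (hd.notMem_of_mem_right hff)
      rw [e1, hκ g hcg hg hgf]
      simp [hwf', hwf, hwc, hwc']
      ring
    · rw [hzero fun π hπ => (hS π hπ c).not_between hcc hf hwc']
      simp [hwf', hwf, hwc, hwc']
  have hsize : ∀ x, ∑ w, (if w ∈ subtreeVertices G r x then (1 : ℝ) else 0) =
      directionalSize G r x := by
    intro x
    rw [Finset.sum_boole, directionalSize, Set.ncard_eq_toFinset_card']
    congr 2
    ext
    simp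
  rw [sum_edgeLength_eq_card_add_sum_card_between S hcf.ne, Finset.sum_congr rfl fun w _ => hcard w,
    ← Finset.mul_sum, Finset.sum_add_distrib, ← Finset.sum_mul, ← Finset.mul_sum,
    Finset.sum_sub_distrib, Finset.sum_sub_distrib, Finset.sum_sub_distrib, hsize, hsize,
    Finset.sum_ite_eq' , Finset.sum_ite_eq']
  simp
  ring

open Classical in
theorem card_between_siblings (hG : G.IsTree) {S : Finset (Arrangement V)}
    (hS : ∀ π ∈ S, π.IsHierarchical G r) {c f g : V} (hcf : G.Adj c f)
    (hf : f ∈ subtreeVertices G r c) (hcg : G.Adj c g) (hg : g ∈ subtreeVertices G r c)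
    (hgf : g ≠ f) (hswap : ∀ π ∈ S,
      π.blockSwap (subtreeVertices G r f) (subtreeVertices G r g) f g ∈ S) :
    (S.filter fun π => π.Between c f g).card = (S.filter fun π => π.Between c g f).card :=
  card_between_eq_of_blockSwap S
    (hG.disjoint_subtreeVertices_of_siblings hcf hf hcg hg hgf.symm)
    (hG.self_mem_subtreeVertices r f) (hG.self_mem_subtreeVertices r g) (fun π hπ => hS π hπ f)
    (fun π hπ => hS π hπ g) hswap (fun h => hcf.ne (hG.subtreeVertices_antisymm hf h))
    (fun h => hcg.ne (hG.subtreeVertices_antisymm hg h))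

/-- The total length of the edge from `c` to its child `f`, over a set of hierarchical arrangements
in which all the swaps at `c` and `f` are possible. -/
theorem sum_edgeLength_of_swaps (hG : G.IsTree) {S : Finset (Arrangement V)}
    (hS : ∀ π ∈ S, π.IsHierarchical G r) {c f : V} (hcf : G.Adj c f)
    (hf : f ∈ subtreeVertices G r c)
    (hchild : ∀ x, x = c ∨ x = f → ∀ g, G.Adj x g → g ∈ subtreeVertices G r x →
      ∀ π ∈ S, π.blockSwap {x} (subtreeVertices G r g) x g ∈ S)
    (hsib : ∀ g, G.Adj c g → g ∈ subtreeVertices G r c → g ≠ f → ∀ π ∈ S,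
      π.blockSwap (subtreeVertices G r f) (subtreeVertices G r g) f g ∈ S) :
    ∑ π ∈ S, π.edgeLength c f = S.card *
      ((2 * (directionalSize G r c : ℝ) + directionalSize G r f + 1) / 6) := by
  classical
  rw [sum_edgeLength_of_isHierarchical hG hS hcf hf (hchild f (Or.inr rfl)) (1 / 3)]
  · ring
  intro g hcg hg hgf
  have hcf' : c ∉ subtreeVertices G r f := fun h =>
    hcf.ne (hG.subtreeVertices_antisymm hf h)
  have hgf' := (hG.disjoint_subtreeVertices_of_siblings hcf hf hcg hg hgf.symm).notMem_of_mem_right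
    (hG.self_mem_subtreeVertices r g)
  have e1 := card_between_siblings hG hS hcf hf hcg hg hgf (hsib g hcg hg hgf)
  have e2 := card_between_eq_of_blockSwap S (Set.disjoint_singleton_left.2 hcf')
    (Set.mem_singleton c) (hG.self_mem_subtreeVertices r f) (fun π _ => π.isBlock_singleton c)
    (fun π hπ => hS π hπ f) (hchild c (Or.inl rfl) f hcf hf) (z := g)
    (by simpa using hcg.ne') hgf'
  -- Exactly one of `c`, `f`, `g` is in the middle, and the swaps make the three cases equally
  -- frequent; hence `κ` is 1/3.
  have e3 : (S.filter fun π => ¬ π.Between c g f) =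
      (S.filter fun π => π.Between c f g) ∪ S.filter fun π => π.Between g c f := by
    rw [← Finset.filter_or]
    refine Finset.filter_congr fun π hπ => ?_
    have h2 := π.lt_or_lt_of_ne hcf.ne
    have h3 := π.lt_or_lt_of_ne hgf
    have h4 := π.lt_or_lt_of_ne hcg.ne
    simp only [Between]
    grind
  have e4 : Disjoint (S.filter fun π => π.Between c f g) (S.filter fun π => π.Between g c f) := by
    refine Finset.disjoint_filter.2 fun π _ => ?_
    simp only [Between]
    grind
  have e5 := Finset.card_filter_add_card_filter_not (s := S) (fun π => π.Between c g f)
  have e6 : (S.filter fun π => π.Between g f c) = S.filter fun π => π.Between c f g :=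
    Finset.filter_congr fun π _ => between_comm
  rw [e3, Finset.card_union_of_disjoint e4, e2, e6, e1] at e5
  have e7 : ((S.filter fun π => π.Between c g f).card : ℝ) +
    ((S.filter fun π => π.Between c g f).card + (S.filter fun π => π.Between c g f).card)
      = S.card := by exact_mod_cast e5
  linarith

/-! ### Rotations and the first vertex -/

/-- Planarity is invariant under rotating the positions. -/
theorem IsPlanar.rotate [NeZero (Fintype.card V)] {π : Arrangement V} (h : π.IsPlanar G)
    (k : Fin (Fintype.card V)) : IsPlanar G (π.trans (Equiv.addRight k)) := by
  rintro s t u v hst huv hlt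
  -- A rotation can only shift the order of the four endpoints cyclically; these are the four cyclic
  -- renamings of a crossing.
  have h1 := h s t u v hst huv
  have h2 := h u v t s huv hst.symm
  have h3 := h t s v u hst.symm huv.symm
  have h4 := h v u s t huv.symm hst
  have hs := (π s).isLt
  have ht := (π t).isLt
  have hu := (π u).isLt
  have hv := (π v).isLt
  have hk := k.isLt
  simp only [Equiv.trans_apply, Equiv.coe_addRight, Fin.lt_def, Fin.val_add] at *
  have hmod : ∀ a : ℕ, a < Fintype.card V → (a + k) % Fintype.card V = a + k ∧
      a + k < Fintype.card V ∨ (a + k) % Fintype.card V + Fintype.card V = a + k := by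
    intro a ha
    rcases lt_or_ge (a + k) (Fintype.card V) with h | h
    · exact Or.inl ⟨Nat.mod_eq_of_lt h, h⟩
    · right
      rw [Nat.mod_eq_sub_mod h, Nat.mod_eq_of_lt (by omega)]
      omega
  have ms := hmod _ hs
  have mt := hmod _ ht
  have mu := hmod _ hu
  have mv := hmod _ hv
  omega

theorem isFirst_iff [NeZero (Fintype.card V)] {π : Arrangement V} : π.IsFirst r ↔ π r = 0 := by
  constructor
  · intro h
    by_contra h0
    have := h (π.symm 0) fun e => h0 (by rw [← e, Equiv.apply_symm_apply])
    simp at this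
  · intro h w hw
    rw [h]
    exact Fin.pos_iff_ne_zero.2 fun e => hw (π.injective (e.trans h.symm))

/-! ### Projective arrangements and planar arrangements with a prescribed first vertex -/

variable [DecidableEq V]

theorem mem_projectiveArrangements_iff (hG : G.IsTree) {π : Arrangement V} :
    π ∈ projectiveArrangements G r ↔ π.IsHierarchical G r := by
  classical
  rw [projectiveArrangements, Finset.mem_filter]
  exact ⟨fun h => h.2.isHierarchical hG, fun h => ⟨Finset.mem_univ _, h.isProjective hG⟩⟩

theorem expectedLengthProjective_of_child (hG : G.IsTree) {c f : V} (hcf : G.Adj c f)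
    (hf : f ∈ subtreeVertices G r c) : expectedLengthProjective G r c f =
      (2 * (directionalSize G r c : ℝ) + directionalSize G r f + 1) / 6 := by
  have hne : ((projectiveArrangements G r).card : ℝ) ≠ 0 := by
    obtain ⟨π, hπ, -⟩ := exists_isHierarchical_isFirst hG r
    exact_mod_cast Finset.card_ne_zero_of_mem ((mem_projectiveArrangements_iff hG).2 hπ)
  rw [expectedLengthProjective, uniformExpectation, sum_edgeLength_of_swaps hG
    (fun π hπ => (mem_projectiveArrangements_iff hG).1 hπ) hcf hf]
  · field_simp
  · intro x _ g hxg hg π hπ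
    rw [mem_projectiveArrangements_iff hG] at hπ ⊢
    exact hπ.blockSwap_child hG hxg hg
  · intro g hcg hg hgf π hπ
    rw [mem_projectiveArrangements_iff hG] at hπ ⊢
    exact hπ.blockSwap_siblings hG hcf hf hcg hg hgf.symm

open Classical in
/-- The planar arrangements of `G` in which `r` comes first. -/
noncomputable def planarArrangementsFirst (G : SimpleGraph V) (r : V) : Finset (Arrangement V) :=
  (planarArrangements G).filter fun π => π.IsFirst r

/-- No edge can cover a vertex in first position, so planar and projective agree here. -/
theorem mem_planarArrangementsFirst_iff (hG : G.IsTree) {π : Arrangement V} :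
    π ∈ planarArrangementsFirst G r ↔ π.IsHierarchical G r ∧ π.IsFirst r := by
  classical
  rw [planarArrangementsFirst, Finset.mem_filter, planarArrangements, Finset.mem_filter]
  constructor
  · rintro ⟨⟨-, h1⟩, h2⟩
    refine ⟨IsProjective.isHierarchical hG ⟨h1, fun s t _ h => ?_⟩, h2⟩
    exact absurd (h2 s fun e => h.1.ne (by rw [e])) (not_lt.2 h.1.le)
  · rintro ⟨h1, h2⟩
    exact ⟨⟨Finset.mem_univ _, (h1.isProjective hG).1⟩, h2⟩

/-- Since `c` is not the root, all swaps at `c` and `f` leave `r` in place, and the projective count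
applies unchanged. -/
theorem sum_edgeLength_planarArrangementsFirst_of_ne (hG : G.IsTree) {c f : V}
    (hcf : G.Adj c f) (hf : f ∈ subtreeVertices G r c) (hc : c ≠ r) :
    ∑ π ∈ planarArrangementsFirst G r, π.edgeLength c f =
      (planarArrangementsFirst G r).card * expectedLengthProjective G r c f := by
  have hroot : ∀ {x}, x ≠ r → r ∉ subtreeVertices G r x := fun hx h =>
    hx (SimpleGraph.eq_of_root_mem_subtreeVertices h)
  have hbelow : ∀ {x y}, y ∈ subtreeVertices G r x → x ≠ r → y ≠ r := fun hy hx e =>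
    hroot hx (e ▸ hy)
  rw [expectedLengthProjective_of_child hG hcf hf, sum_edgeLength_of_swaps hG
    (fun π hπ => ((mem_planarArrangementsFirst_iff hG).1 hπ).1) hcf hf]
  · intro x hx g hxg hg π hπ
    have hxr : x ≠ r := by
      rcases hx with rfl | rfl
      · exact hc
      · exact hbelow hf hc
    rw [mem_planarArrangementsFirst_iff hG] at hπ ⊢
    refine ⟨hπ.1.blockSwap_child hG hxg hg, hπ.2.blockSwap ?_ (Set.mem_singleton x)
      (hG.self_mem_subtreeVertices r g) (by simpa using hxr.symm) (hroot (hbelow hg hxr))⟩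
    exact Set.disjoint_singleton_left.2 fun h => hxg.ne (hG.subtreeVertices_antisymm hg h)
  · intro g hcg hg hgf π hπ
    rw [mem_planarArrangementsFirst_iff hG] at hπ ⊢
    exact ⟨hπ.1.blockSwap_siblings hG hcf hf hcg hg hgf.symm, hπ.2.blockSwap
      (hG.disjoint_subtreeVertices_of_siblings hcf hf hcg hg hgf.symm)
      (hG.self_mem_subtreeVertices r f) (hG.self_mem_subtreeVertices r g)
      (hroot (hbelow hf hc)) (hroot (hbelow hg hc))⟩

/-- With `r` first, only `f` or `g` can be in the middle, so `κ` is 1/2 and the mean is 1 + (n_f -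
1)/2 + (n - n_f - 1)/2 = n/2. -/
theorem sum_edgeLength_planarArrangementsFirst_root (hG : G.IsTree) {f : V} (hrf : G.Adj r f) :
    ∑ π ∈ planarArrangementsFirst G r, π.edgeLength r f =
      (planarArrangementsFirst G r).card * ((Fintype.card V : ℝ) / 2) := by
  classical
  have hroot : ∀ {x}, x ≠ r → r ∉ subtreeVertices G r x := fun hx h =>
    hx (SimpleGraph.eq_of_root_mem_subtreeVertices h)
  have hf := hG.mem_subtreeVertices_root r f
  have hS := fun π hπ => ((mem_planarArrangementsFirst_iff (r := r) (π := π) hG).1 hπ).1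
  have hsize : directionalSize G r r = Fintype.card V := by
    rw [directionalSize, Set.eq_univ_of_forall (hG.mem_subtreeVertices_root r), Set.ncard_univ,
      Nat.card_eq_fintype_card]
  rw [sum_edgeLength_of_isHierarchical hG hS hrf hf ?_ (1 / 2), hsize]
  · ring
  · intro g hrg hg hgf
    have e1 := card_between_siblings hG hS hrf hf hrg hg hgf fun π hπ => by
      rw [mem_planarArrangementsFirst_iff hG] at hπ ⊢
      exact ⟨hπ.1.blockSwap_siblings hG hrf hf hrg hg hgf.symm, hπ.2.blockSwap
        (hG.disjoint_subtreeVertices_of_siblings hrf hf hrg hg hgf.symm)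
        (hG.self_mem_subtreeVertices r f) (hG.self_mem_subtreeVertices r g)
        (hroot hrf.ne') (hroot hrg.ne')⟩
    have e2 : ((planarArrangementsFirst G r).filter fun π => π.Between r f g) =
        (planarArrangementsFirst G r).filter fun π => ¬ π.Between r g f := by
      refine Finset.filter_congr fun π hπ => ?_
      have h1 := ((mem_planarArrangementsFirst_iff hG).1 hπ).2
      have h2 := h1 f hrf.ne'
      have h3 := h1 g hrg.ne'
      have h4 := π.lt_or_lt_of_ne hgf
      simp only [Between]
      grind
    have e3 := Finset.card_filter_add_card_filter_not (s := planarArrangementsFirst G r)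
      (fun π => π.Between r g f)
    rw [← e2, e1] at e3
    have e4 : (((planarArrangementsFirst G r).filter fun π => π.Between r g f).card : ℝ) +
      ((planarArrangementsFirst G r).filter fun π => π.Between r g f).card =
        (planarArrangementsFirst G r).card := by exact_mod_cast e3
    linarith
  · intro g hfg hg π hπ
    rw [mem_planarArrangementsFirst_iff hG] at hπ ⊢
    have hgf : f ∉ subtreeVertices G r g := fun h =>
      hfg.ne (hG.subtreeVertices_antisymm hg h)
    have hgr : g ≠ r := fun e => hgf (e ▸ hf)
    exact ⟨hπ.1.blockSwap_child hG hfg hg, hπ.2.blockSwap (Set.disjoint_singleton_left.2 hgf)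
      (Set.mem_singleton f) (hG.self_mem_subtreeVertices r g) (by simpa using hrf.ne)
      (hroot hgr)⟩

/-- Rotating by `-k` matches the planar arrangements having `r` at position `k` with those having
`r` first. In particular the latter number does not depend on `r`. -/
theorem card_planarArrangements (G : SimpleGraph V) (r : V) :
    (planarArrangements G).card = Fintype.card V * (planarArrangementsFirst G r).card := by
  classical
  have : Nonempty V := ⟨r⟩
  have : NeZero (Fintype.card V) := ⟨Fintype.card_ne_zero⟩
  have hmem : ∀ π : Arrangement V, π ∈ planarArrangements G ↔ π.IsPlanar G := fun π => by
    simp [planarArrangements]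
  rw [Finset.card_eq_sum_card_fiberwise (f := fun π : Arrangement V => π r) (t := Finset.univ)
    fun _ _ => Finset.mem_coe.2 (Finset.mem_univ _)]
  rw [Finset.sum_const_nat (m := (planarArrangementsFirst G r).card), Finset.card_univ,
    Fintype.card_fin]
  intro k _
  refine Finset.card_nbij' (fun π => π.trans (Equiv.addRight (-k)))
    (fun π => π.trans (Equiv.addRight k)) ?_ ?_ ?_ ?_
  · intro π hπ
    simp only [planarArrangementsFirst, Finset.coe_filter, Set.mem_ofPred_eq, hmem,
      isFirst_iff] at hπ ⊢
    exact ⟨hπ.1.rotate _, by simp [hπ.2]⟩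
  · intro π hπ
    simp only [planarArrangementsFirst, Finset.coe_filter, Set.mem_ofPred_eq, hmem,
      isFirst_iff] at hπ ⊢
    exact ⟨hπ.1.rotate _, by simp [hπ.2]⟩
  · intro π _
    apply Equiv.ext
    simp
  · intro π _
    apply Equiv.ext
    simp

theorem sum_planarArrangements (G : SimpleGraph V) (X : Arrangement V → ℝ) [Nonempty V] :
    ∑ π ∈ planarArrangements G, X π = ∑ r, ∑ π ∈ planarArrangementsFirst G r, X π := by
  classical
  have : NeZero (Fintype.card V) := ⟨Fintype.card_ne_zero⟩
  rw [← Finset.sum_fiberwise (planarArrangements G) (fun π => π.symm 0) X]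
  refine Finset.sum_congr rfl fun r _ => Finset.sum_congr ?_ fun _ _ => rfl
  rw [planarArrangementsFirst]
  refine Finset.filter_congr fun π _ => ?_
  rw [isFirst_iff, Equiv.symm_apply_eq, eq_comm]

end Arrangement

open Arrangement in
theorem mainTheorem4 {V : Type*} [Fintype V] [DecidableEq V] (G : SimpleGraph V)
    (hG : G.IsTree) (u v : V) (huv : G.Adj u v) :
    expectedLengthPlanar G u v =
        1 + (1 / (Fintype.card V : ℝ)) *
          ∑ r ∈ Finset.univ \ {u, v}, expectedLengthProjective G r u v ∧
      ∀ r : V, expectedLengthProjective G r u v =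
        (2 * (directionalSize G r (closestEndpoint G r u v) : ℝ) +
          (directionalSize G r (farthestEndpoint G r u v) : ℝ) + 1) / 6 := by
  have hcomm : ∀ r, expectedLengthProjective G r u v = expectedLengthProjective G r v u :=
    fun r => by simp only [expectedLengthProjective, edgeLength_comm]
  constructor
  · have : Nonempty V := ⟨u⟩
    have hn : (Fintype.card V : ℝ) ≠ 0 := by exact_mod_cast Fintype.card_ne_zero
    obtain ⟨s, hs⟩ : ∃ s, ∀ r, (planarArrangementsFirst G r).card = s :=
      ⟨(planarArrangementsFirst G u).card, fun r => Nat.eq_of_mul_eq_mul_left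
        Fintype.card_pos ((card_planarArrangements G r).symm.trans (card_planarArrangements G u))⟩
    have hs0 : (s : ℝ) ≠ 0 := by
      obtain ⟨π, hπ⟩ := exists_isHierarchical_isFirst hG u
      rw [← hs u]
      exact_mod_cast Finset.card_ne_zero_of_mem ((mem_planarArrangementsFirst_iff hG).2 hπ)
    have hother : ∀ r ∈ Finset.univ \ {u, v}, ∑ π ∈ planarArrangementsFirst G r,
        π.edgeLength u v = s * expectedLengthProjective G r u v := by
      intro r hr
      simp only [Finset.mem_sdiff, Finset.mem_univ, true_and, Finset.mem_insert,
        Finset.mem_singleton, not_or] at hr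
      rcases hG.adj_mem_subtreeVertices_or r huv with h | h
      · rw [sum_edgeLength_planarArrangementsFirst_of_ne hG huv h (Ne.symm hr.1), hs]
      · rw [hcomm, ← hs r,
          ← sum_edgeLength_planarArrangementsFirst_of_ne hG huv.symm h (Ne.symm hr.2)]
        simp only [edgeLength_comm]
    have hu := sum_edgeLength_planarArrangementsFirst_root hG huv
    have hv := sum_edgeLength_planarArrangementsFirst_root hG huv.symm
    simp only [edgeLength_comm _ v u] at hv
    -- The first vertices `u` and `v` contribute `s * n / 2` each; divided by the total count `n *
    -- s`, they give the summand 1.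
    rw [expectedLengthPlanar, uniformExpectation, sum_planarArrangements,
      ← Finset.sum_sdiff (Finset.subset_univ {u, v}), Finset.sum_pair huv.ne, hu, hv,
      Finset.sum_congr rfl hother, ← Finset.mul_sum, card_planarArrangements G u, hs, hs]
    push_cast
    field_simp
    ring
  · intro r
    rw [closestEndpoint, farthestEndpoint]
    split_ifs with h
    · exact expectedLengthProjective_of_child hG huv (hG.mem_subtreeVertices_of_dist_lt huv h)
    · rw [hcomm]
      exact expectedLengthProjective_of_child hG huv.symm
        (hG.mem_subtreeVertices_of_not_dist_lt huv h)
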